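/- **Proposition.** Let $1\le m\le n$ be integers and let $\mathbf v=(v_1,\dots,v_n)$ be positive reals with $v_1+\dots+v_n=n$ and $v_1=\max_i v_i$. Balls in $\mathbb R^m$ are taken in the supremum norm, $|\cdot|_m$ is Lebesgue measure on $\mathbb R^m$, and $\|\cdot\|$ is the distance to the nearest integer. Let $U\subset\mathbb R^m$ be open, let $\theta:U\to\mathbb R$ be $C^2$, and let $\mathbf f=(f_1,\dots,f_n):U\to\mathbb R^n$ be a $C^2$ map with $f_i(\mathbf x)=x_i$ for $1\le i\le m$. For $\mathbf a\in\mathbb R^n$ put $|\mathbf a|_{\mathbf v}=\max_i|a_i|^{1/v_i}$, and let $\Phi(Q,\delta)$ be the set of $\mathbf x\in U$ for which some $\mathbf a\in\mathbb Z^n\setminus\{0\}$ satisfies $\|\mathbf a\cdot\mathbf f(\mathbf x)\|<\delta Q^{-n}$ and $|\mathbf a|_{\mathbf v}\le Q$. Assume that $\mathbf f$ is $\mathbf v$-nice at $\mathbf x_0\in U$: there are a neighbourhood $U'\subset U$ of $\mathbf x_0$ and constants $0<\delta,\omega<1$ such that $\limsup_{Q\to\infty}|\Phi(Q,\delta)\cap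 B|_m\le\omega|B|_m$ for every sufficiently small ball $B\subset U'$. Let $\mathcal F_n$ be the set of forms $F=a_0+a_1f_1+\dots+a_nf_n$ with integer coefficients not all zero, indexed by their coefficients $(a_0,\dots,a_n)$, and put $H_{\mathbf v}(F)=\max_{1\le i\le n}|a_i|^{1/v_i}$. Then there are a ball $U_0\subset U$ that is a neighbourhood of $\mathbf x_0$, constants $\kappa_0>0$ and $\kappa_1>1$, and sets $$R_F\subset\{\mathbf x\in U: F(\mathbf x)+\theta(\mathbf x)=0\}\cap U_0\qquad(F\in\mathcal F_n)$$ such that, with weights $\beta_F=\kappa_0H_{\mathbf v}(F)$, the system $(R_F,\beta_F)_{F\in\mathcal F_n}$ is locally ubiquitous in $U_0$ relative to $\rho(r)=\kappa_1r^{-n-v_1}$ with common dimension $\gamma=m-1$. Writing $J_t=\{F\in\mathcal F_n:\beta_F\le2^t\}$ and $\Delta(A,r)=\{\mathbf x\in U_0:\operatorname{dist}(\mathbf x,A)<r\}$ (with $\Delta(\emptyset,r)=\emptyset$), this means: 1. $\beta_F>0$ whenever $R_F\ne\emptyset$, and for every $t\in\mathbb N$ only finitely many $F\in J_t$ have $R_F\neq\emptyset$;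 2. there are constants $c_1,c_2>0$ such that for all sufficiently large $t$, all $F\in J_t$, all $\mathbf c\in R_F$ and all $0<\lambda\le\rho(2^t)$, $$\big|B(\mathbf c,\tfrac12\rho(2^t))\cap\Delta(R_F,\lambda)\big|_m\ge c_1|B(\mathbf c,\lambda)|_m\Big(\frac{\rho(2^t)}{\lambda}\Big)^{\gamma},$$ $$\big|B\cap B(\mathbf c,3\rho(2^t))\cap\Delta(R_F,3\lambda)\big|_m\le c_2|B(\mathbf c,\lambda)|_m\Big(\frac{r(B)}{\lambda}\Big)^{\gamma}$$ for every ball $B$ centred at a point of some $R_{F'}$, $F'\in\mathcal F_n$, with radius $r(B)\le3\rho(2^t)$; 3. there is a constant $k>0$ such that for every ball $B\subset U_0$, $$\liminf_{t\to\infty}\Big|\bigcup_{F\in J_t}\Delta(R_F,\rho(2^t))\cap B\Big|_m\ge k|B|_m.$$ -/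

import Mathlib

open MeasureTheory Filter Topology

noncomputable section

/-- The `v`-quasinorm `|y|_v = max_i |y_i|^(1/v_i)` on `ℝⁿ`. -/
def quasinorm {n : ℕ} (v y : Fin n → ℝ) : ℝ :=
  ⨆ i, |y i| ^ (1 / v i)

/-- The distance `‖x‖` from a real number to the nearest integer. -/
def distInt (x : ℝ) : ℝ := |x - round x|

/-- The set `Φ_v^f(Q, δ)` of all `x ∈ U` for which some nonzero `a ∈ ℤⁿ` satisfies
`‖a · f(x)‖ < δ Q^(-n)` and `|a|_v ≤ Q`. -/
def smallFormSet {m n : ℕ} (U : Set (Fin m → ℝ)) (f : (Fin m → ℝ) → (Fin n → ℝ))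
    (v : Fin n → ℝ) (Q δ : ℝ) : Set (Fin m → ℝ) :=
  {x | x ∈ U ∧ ∃ a : Fin n → ℤ, a ≠ 0 ∧
    distInt (∑ i, (a i : ℝ) * f x i) < δ * Q ^ (-(n : ℝ)) ∧
    quasinorm v (fun i => (a i : ℝ)) ≤ Q}

/-- `f : U → ℝⁿ` is `v`-nice at `x₀`. Balls are those of the supremum norm, which is the
norm of `Fin m → ℝ`. -/
def IsNiceAt {m n : ℕ} (U : Set (Fin m → ℝ)) (f : (Fin m → ℝ) → (Fin n → ℝ))
    (v : Fin n → ℝ) (x₀ : Fin m → ℝ) : Prop :=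
  ∃ U₀ : Set (Fin m → ℝ), U₀ ∈ 𝓝 x₀ ∧ U₀ ⊆ U ∧
    ∃ δ ω : ℝ, 0 < δ ∧ δ < 1 ∧ 0 < ω ∧ ω < 1 ∧
      ∃ r₀ : ℝ, 0 < r₀ ∧ ∀ (x : Fin m → ℝ) (r : ℝ), 0 < r → r < r₀ →
        Metric.ball x r ⊆ U₀ →
          limsup (fun Q : ℝ => volume (smallFormSet U f v Q δ ∩ Metric.ball x r)) atTop
            ≤ ENNReal.ofReal ω * volume (Metric.ball x r)

/-- `Δ(A, r) = {x ∈ U : dist(x, A) < r}`. (`Metric.thickening` uses the extended distance,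
so `Δ(∅, r) = ∅`.) -/
def nbhdIn {m : ℕ} (U A : Set (Fin m → ℝ)) (r : ℝ) : Set (Fin m → ℝ) :=
  U ∩ Metric.thickening r A

/-- The intersection conditions with common dimension `γ`: there are positive constants
`c₁, c₂` such that for all large `t`, all `α` with `β α ≤ 2^t`, all `c ∈ R α` and all
`0 < l ≤ ρ(2^t)` both inequalities hold, the second one for every ball `B = B(b, r)` centred
at a point of some resonant set, with radius `r ≤ 3 ρ(2^t)`. -/
def IntersectionConditions {m : ℕ} {J : Type*} (U : Set (Fin m → ℝ))
    (R : J → Set (Fin m → ℝ)) (β : J → ℝ) (ρ : ℝ → ℝ) (γ : ℝ) : Prop :=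
  ∃ c₁ c₂ : ℝ, 0 < c₁ ∧ 0 < c₂ ∧ ∃ T : ℕ, ∀ t : ℕ, T ≤ t →
    ∀ α : J, β α ≤ 2 ^ t → ∀ c ∈ R α, ∀ l : ℝ, 0 < l → l ≤ ρ (2 ^ t) →
      ENNReal.ofReal (c₁ * (ρ (2 ^ t) / l) ^ γ) * volume (Metric.ball c l)
          ≤ volume (Metric.ball c (ρ (2 ^ t) / 2) ∩ nbhdIn U (R α) l) ∧
      ∀ (α' : J), ∀ b ∈ R α', ∀ r : ℝ, 0 < r → r ≤ 3 * ρ (2 ^ t) →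
        volume (Metric.ball b r ∩ Metric.ball c (3 * ρ (2 ^ t)) ∩ nbhdIn U (R α) (3 * l))
          ≤ ENNReal.ofReal (c₂ * (r / l) ^ γ) * volume (Metric.ball c l)

/-- The system `(R, β)` of resonant sets and weights is locally ubiquitous in the ball `U`
relative to `ρ`, with common dimension `γ`. Positivity of the weights and finiteness of
`{α : β α ≤ 2^t}` are asked of the indices with nonempty resonant set; the other indices
contribute nothing to any of the conditions. -/
structure IsLocallyUbiquitous {m : ℕ} {J : Type*} [Countable J] (U : Set (Fin m → ℝ))
    (R : J → Set (Fin m → ℝ)) (β : J → ℝ) (ρ : ℝ → ℝ) (γ : ℝ) : Prop where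
  isBall : ∃ (x : Fin m → ℝ) (r : ℝ), 0 < r ∧ U = Metric.ball x r
  dim_nonneg : 0 ≤ γ
  dim_le : γ ≤ m
  rho_pos : ∀ r : ℝ, 0 < r → 0 < ρ r
  rho_tendsto : Tendsto ρ atTop (𝓝 0)
  weight_pos : ∀ α, (R α).Nonempty → 0 < β α
  finite_le : ∀ t : ℕ, {α | (R α).Nonempty ∧ β α ≤ 2 ^ t}.Finite
  intersection : IntersectionConditions U R β ρ γ
  covering : ∃ k : ℝ, 0 < k ∧ ∀ (x : Fin m → ℝ) (r : ℝ), 0 < r → Metric.ball x r ⊆ U →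
    ENNReal.ofReal k * volume (Metric.ball x r) ≤
      liminf (fun t : ℕ => volume
        (⋃ α ∈ {α : J | β α ≤ 2 ^ t}, nbhdIn U (R α) (ρ (2 ^ t)) ∩ Metric.ball x r)) atTop

/-- The index set of the integer forms `F = a₀ + a₁ f₁ + ⋯ + aₙ fₙ`: integer coefficients
`(a₀, (a₁, …, aₙ))`, not all zero. -/
abbrev IntForm (n : ℕ) : Type := {a : ℤ × (Fin n → ℤ) // a ≠ 0}

/-- The value `F(x) = a₀ + a₁ f₁(x) + ⋯ + aₙ fₙ(x)`. -/
def IntForm.eval {m n : ℕ} (F : IntForm n) (f : (Fin m → ℝ) → (Fin n → ℝ))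
    (x : Fin m → ℝ) : ℝ :=
  (F.1.1 : ℝ) + ∑ i, (F.1.2 i : ℝ) * f x i

/-- The height `H_v(F) = max_{1 ≤ i ≤ n} |a_i|^(1/v_i)`. -/
def IntForm.height {n : ℕ} (v : Fin n → ℝ) (F : IntForm n) : ℝ :=
  quasinorm v (fun i => (F.1.2 i : ℝ))

/-- The untrimmed set `{x ∈ U : F(x) + θ(x) = 0}`. -/
def zeroSet {m n : ℕ} (U : Set (Fin m → ℝ)) (f : (Fin m → ℝ) → (Fin n → ℝ))
    (θ : (Fin m → ℝ) → ℝ) (F : IntForm n) : Set (Fin m → ℝ) :=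
  {x | x ∈ U ∧ F.eval f x + θ x = 0}

end

open MeasureTheory Filter Topology

noncomputable section

/-! Niceness says that, for large `Q = 2^t`, a fixed proportion of every small ball lies outside
`Φ(Q, δ)`. At such a point `z` the unimodular lattice of vectors `(Qⁿ(a₀ + a·f(z)), Q^(-v_i) a_i)`
has no nonzero vector shorter than `δ`, so by a packing argument it comes within a bounded distance
of every point (`exists_lattice_point_near`). The target can thus be prescribed: `F(z) + θ(z)` is
`O(Q⁻ⁿ)`, all `a_i` are `O(Q^(v_i))`, and `a₁` is at least `Q^(v₁)` and dominates the rest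
(`exists_dominated_form`). Domination is possible because `v₁` is the largest weight.

Since `f₁ = x₁`, dividing `F + θ` by `a₁` gives `x₁` plus a function of small Lipschitz constant.
Its zero set is a Lipschitz graph over the other coordinates, at distance `O(Q^(-n-v₁))` from `z`;
this gives the covering condition.

The intersection conditions compare tubes around graphs. Near the boundary of `U₀` the lower bound
could fail, so `R_F` keeps only zeros within `1/a₁` of a zero of depth `1/a₁` in `U₀`. This scale is
at least `ρ(2^t)` for all `F ∈ J_t` with nonempty `R_F`, once `t` is large, yet tends to `0` for the
forms that do the covering. -/

/-! ### Geometry of numbers: from badly approximable points to inhomogeneous solutions. -/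

/-- An inhomogeneous consequence of Minkowski's theory: if the unimodular lattice `T(ℤᵈ)` has no
nonzero vector of norm less than `δ`, then every point is within `C(d, δ)` of the lattice. -/
theorem exists_lattice_point_near (ι : Type*) [Fintype ι] {δ : ℝ} (hδ : 0 < δ) :
    ∃ C : ℝ, 0 < C ∧ ∀ T : (ι → ℝ) →ₗ[ℝ] (ι → ℝ), LinearMap.det T = 1 →
      (∀ z : ι → ℤ, z ≠ 0 → δ ≤ ‖T (fun i => (z i : ℝ))‖) →
      ∀ y : ι → ℝ, ∃ z : ι → ℤ, ‖T (fun i => (z i : ℝ)) - y‖ < C := by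
  classical
  -- A sup-norm ball of radius `δ / 2` has volume `δ ^ d`, so `N` of them have total volume greater
  -- than `1`.
  obtain ⟨N, hN⟩ := exists_nat_gt (1 / δ ^ Fintype.card ι)
  have hδd : 0 < δ ^ Fintype.card ι := by positivity
  rw [div_lt_iff₀ hδd] at hN
  refine ⟨N * δ + 1, by positivity, fun T hT hmin y => ?_⟩
  set Λ : Set (ι → ℝ) := Set.range fun z : ι → ℤ => T (fun i => (z i : ℝ)) with hΛ
  have h0 : (0 : ι → ℝ) ∈ Λ := ⟨0, by
    have : (fun i => (((0 : ι → ℤ) i : ℤ) : ℝ)) = 0 := by ext; simp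
    simp only [this, map_zero]⟩
  have hne : Λ.Nonempty := ⟨0, h0⟩
  suffices hD : Metric.infDist y Λ < N * δ + 1 by
    obtain ⟨_, ⟨z, rfl⟩, hz⟩ := (Metric.infDist_lt_iff hne).1 hD
    exact ⟨z, by rwa [dist_comm, dist_eq_norm] at hz⟩
  by_contra! hlt
  have hinv : ∀ (x : ι → ℝ) (z : ι → ℤ),
      Metric.infDist (x + T (fun i => (z i : ℝ))) Λ = Metric.infDist x Λ := by
    intro x z
    have him : (fun u => u + T (fun i => (z i : ℝ))) '' Λ = Λ := by
      ext u
      constructor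
      · rintro ⟨_, ⟨w, rfl⟩, rfl⟩
        refine ⟨w + z, ?_⟩
        simp only [← map_add]
        congr 1; ext i; simp
      · rintro ⟨w, rfl⟩
        refine ⟨_, ⟨w - z, rfl⟩, ?_⟩
        simp only [← map_add]
        congr 1; ext i; simp
    have := Metric.infDist_image (x := x) (t := Λ)
      (isometry_add_right (T (fun i => (z i : ℝ))))
    rwa [him] at this
  -- On the segment from `0` to the supposedly remote point `y`, the distance to `Λ` takes each of
  -- the values `0, δ, …, (N - 1)δ`.
  have hpts : ∀ k : ℕ, k < N → ∃ x : ι → ℝ, Metric.infDist x Λ = k * δ := by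
    intro k hk
    have hcont : ContinuousOn (fun s : ℝ => Metric.infDist (s • y) Λ) (Set.Icc 0 1) := by
      have := Metric.continuous_infDist_pt Λ
      fun_prop
    have hivt := intermediate_value_Icc zero_le_one hcont
    have hk' : (k : ℝ) * δ ≤ N * δ := by gcongr
    obtain ⟨s, -, hs⟩ := hivt (show (k : ℝ) * δ ∈ _ from
      ⟨by simp only [zero_smul, Metric.infDist_zero_of_mem h0]; positivity, by
        simp only [one_smul]; linarith⟩)
    exact ⟨_, hs⟩
  choose! p hp using hpts
  set S : Set (ι → ℝ) := ⋃ k ∈ Finset.range N, Metric.ball (p k) (δ / 2) with hS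
  -- The distance to `Λ` is 1-Lipschitz and `Λ`-periodic, so points of two balls that are congruent
  -- modulo `Λ` have centres whose distances to `Λ` differ by less than `δ`.
  have hdisj : ∀ k < N, ∀ l < N, ∀ u u' : ι → ℝ, ∀ z : ι → ℤ, u ∈ Metric.ball (p k) (δ / 2) →
      u' ∈ Metric.ball (p l) (δ / 2) → u = u' + T (fun i => (z i : ℝ)) → k = l := by
    intro k hk l hl u u' z hu hu' huu
    have h1 := Metric.infDist_le_infDist_add_dist (s := Λ) (x := p k) (y := u)
    have h2 := Metric.infDist_le_infDist_add_dist (s := Λ) (x := u) (y := p k)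
    have h3 := Metric.infDist_le_infDist_add_dist (s := Λ) (x := p l) (y := u')
    have h4 := Metric.infDist_le_infDist_add_dist (s := Λ) (x := u') (y := p l)
    have h5 : Metric.infDist u Λ = Metric.infDist u' Λ := by rw [huu, hinv]
    rw [Metric.mem_ball] at hu hu'
    rw [hp k hk, dist_comm] at h1
    rw [hp k hk] at h2
    rw [hp l hl, dist_comm] at h3
    rw [hp l hl] at h4
    have ha : (k : ℝ) < l + 1 := by
      have : (k : ℝ) * δ < (l + 1) * δ := by linarith
      exact lt_of_mul_lt_mul_right this hδ.le
    have hb : (l : ℝ) < k + 1 := by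
      have : (l : ℝ) * δ < (k + 1) * δ := by linarith
      exact lt_of_mul_lt_mul_right this hδ.le
    norm_cast at ha hb
    omega
  have hSmeas : MeasurableSet S :=
    Finset.measurableSet_biUnion _ fun _ _ => measurableSet_ball
  have hSvol : volume S = ENNReal.ofReal (N * δ ^ Fintype.card ι) := by
    rw [hS, measure_biUnion_finset]
    · simp only [Real.volume_pi_ball _ (half_pos hδ), Finset.sum_const, Finset.card_range]
      rw [mul_div_cancel₀ _ two_ne_zero, ENNReal.ofReal_mul (by positivity), nsmul_eq_mul,
        ENNReal.ofReal_natCast]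
    · intro k hk l hl hkl
      rw [Function.onFun, Set.disjoint_left]
      intro u hu hu'
      refine hkl (hdisj k (by simpa using hk) l (by simpa using hl) u u 0 hu hu' ?_)
      have : (fun i => (((0 : ι → ℤ) i : ℤ) : ℝ)) = 0 := by ext; simp
      rw [this, map_zero, add_zero]
    · exact fun _ _ => measurableSet_ball
  have hpre : volume (T ⁻¹' S) = ENNReal.ofReal (N * δ ^ Fintype.card ι) := by
    rw [Measure.addHaar_preimage_linearMap volume (by rw [hT]; exact one_ne_zero), hT, hSvol]
    simp
  have hTmeas : Measurable T := T.continuous_of_finiteDimensional.measurable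
  have hfund : volume (ZSpan.fundamentalDomain (Pi.basisFun ℝ ι)) = 1 := by
    rw [ZSpan.fundamentalDomain_pi_basisFun, Real.volume_pi_Ico]
    simp
  have : VAddInvariantMeasure (Submodule.span ℤ (Set.range (Pi.basisFun ℝ ι))).toAddSubgroup
      (ι → ℝ) volume := inferInstance
  have : Countable (Submodule.span ℤ (Set.range (Pi.basisFun ℝ ι))).toAddSubgroup :=
    inferInstanceAs (Countable (Submodule.span ℤ (Set.range (Pi.basisFun ℝ ι))))
  -- Blichfeldt's principle for `ℤᵈ`, applied to `T ⁻¹' S`: its volume exceeds `1` since `det T =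
  -- 1`.
  obtain ⟨a, b, hab, hnd⟩ := exists_pair_mem_lattice_not_disjoint_vadd
    (ZSpan.isAddFundamentalDomain' (Pi.basisFun ℝ ι) volume)
    (hTmeas hSmeas).nullMeasurableSet (by
      rw [hfund, hpre, ← ENNReal.ofReal_one]
      exact (ENNReal.ofReal_lt_ofReal_iff (by linarith)).2 hN)
  obtain ⟨w, ⟨u, hu, hwu⟩, ⟨u', hu', hwu'⟩⟩ := Set.not_disjoint_iff.1 hnd
  have hint : ∀ c ∈ (Submodule.span ℤ (Set.range (Pi.basisFun ℝ ι))).toAddSubgroup,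
      ∃ z : ι → ℤ, c = fun i => (z i : ℝ) := by
    intro c hc
    have := (Module.Basis.mem_span_iff_repr_mem ℤ (Pi.basisFun ℝ ι) c).1 hc
    choose z hz using this
    exact ⟨z, by ext i; simpa using (hz i).symm⟩
  obtain ⟨z, hz⟩ := hint (b - a : (ι → ℝ)) (sub_mem b.2 a.2)
  have huu : u = u' + fun i => (z i : ℝ) := by
    rw [← hz]
    have h1 : (a : ι → ℝ) + u = w := hwu
    have h2 : (b : ι → ℝ) + u' = w := hwu'
    have : (a : ι → ℝ) + u = b + u' := by rw [h1, h2]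
    rw [eq_comm, ← sub_eq_zero] at this ⊢
    rw [← this]; abel
  have hz0 : z ≠ 0 := by
    rintro rfl
    apply hab
    have : (b - a : ι → ℝ) = 0 := by rw [hz]; ext; simp
    exact (Subtype.ext (sub_eq_zero.1 this)).symm
  have hTuu : T u = T u' + T (fun i => (z i : ℝ)) := by rw [huu, map_add]
  simp only [hS, Set.mem_preimage, Set.mem_iUnion, Finset.mem_range, exists_prop] at hu hu'
  obtain ⟨k, hk, hku⟩ := hu
  obtain ⟨l, hl, hlu⟩ := hu'
  -- The two congruent points lie in one ball of diameter `δ`, so their difference is a nonzero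
  -- lattice vector of norm less than `δ`.
  obtain rfl := hdisj k hk l hl _ _ z hku hlu hTuu
  have h1 := hmin z hz0
  have h2 : T (fun i => (z i : ℝ)) = T u - T u' := by rw [hTuu]; abel
  rw [h2, ← dist_eq_norm] at h1
  have h3 := dist_triangle_right (T u) (T u') (p k)
  rw [Metric.mem_ball] at hku hlu
  linarith

theorem rpow_one_div_le_of_le_rpow {x q w : ℝ} (hx : 0 ≤ x) (hq : 0 ≤ q) (hw : 0 < w)
    (h : x ≤ q ^ w) : x ^ (1 / w) ≤ q := by
  calc x ^ (1 / w) ≤ (q ^ w) ^ (1 / w) := Real.rpow_le_rpow hx h (by positivity)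
    _ = q := by rw [← Real.rpow_mul hq, mul_one_div_cancel hw.ne', Real.rpow_one]

/-- If `w ∈ ℝⁿ` is badly approximable at height `Q`, then the inhomogeneous system with arbitrary
targets `τ` and `b` is solvable at height `Q`. -/
theorem exists_inhomogeneous_approx (n : ℕ) {δ : ℝ} (hδ : 0 < δ) (hδ1 : δ < 1) :
    ∃ C : ℝ, 0 < C ∧ ∀ v : Fin n → ℝ, (∀ i, 0 < v i) → ∑ i, v i = n →
      ∀ (w : Fin n → ℝ) (Q : ℝ), 1 ≤ Q →
      (∀ a : Fin n → ℤ, a ≠ 0 → quasinorm v (fun i => (a i : ℝ)) ≤ Q →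
        δ * Q ^ (-(n : ℝ)) ≤ distInt (∑ i, (a i : ℝ) * w i)) →
      ∀ (τ : ℝ) (b : Fin n → ℝ), ∃ (a₀ : ℤ) (a : Fin n → ℤ),
        |a₀ + ∑ i, (a i : ℝ) * w i - τ| < C * Q ^ (-(n : ℝ)) ∧
        ∀ i, |a i - b i| < C * Q ^ v i := by
  obtain ⟨C, hC, hlat⟩ := exists_lattice_point_near (Fin (n + 1)) hδ
  refine ⟨C, hC, fun v hv hsum w Q hQ hbad τ b => ?_⟩
  have hQ0 : 0 < Q := by linarith
  -- The map `(a₀, a) ↦ (Qⁿ(a₀ + a·w), Q^(-v_i) a_i)`. It is upper triangular with determinant `Q^(n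
  -- - ∑ v_i) = 1`.
  set A : Matrix (Fin (n + 1)) (Fin (n + 1)) ℝ := Matrix.of fun i j =>
    Fin.cases (Fin.cases (Q ^ (n : ℝ)) (fun j' => Q ^ (n : ℝ) * w j') j)
      (fun i' => Fin.cases 0 (fun j' => if i' = j' then Q ^ (-v i') else 0) j) i with hA
  have hA0 : ∀ y : Fin (n + 1) → ℝ,
      A.toLin' y 0 = Q ^ (n : ℝ) * (y 0 + ∑ i : Fin n, y i.succ * w i) := by
    intro y
    simp only [Matrix.toLin'_apply, Matrix.mulVec, dotProduct, hA, Fin.sum_univ_succ,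
      Matrix.of_apply, Fin.cases_zero, Fin.cases_succ, mul_add, Finset.mul_sum]
    congr 1
    exact Finset.sum_congr rfl fun i _ => by ring
  have hAs : ∀ (y : Fin (n + 1) → ℝ) (i : Fin n),
      A.toLin' y i.succ = Q ^ (-v i) * y i.succ := by
    intro y i
    simp [Matrix.toLin'_apply, Matrix.mulVec, dotProduct, hA, Fin.sum_univ_succ]
  have hdet : LinearMap.det A.toLin' = 1 := by
    rw [LinearMap.det_toLin', Matrix.det_of_isUpperTriangular, Fin.prod_univ_succ]
    · simp only [hA, Matrix.of_apply, Fin.cases_zero, Fin.cases_succ, if_true]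
      rw [← Real.rpow_sum_of_pos hQ0, Finset.sum_neg_distrib, hsum, ← Real.rpow_add hQ0]
      simp
    · intro i j hij
      simp only [id] at hij
      induction i using Fin.cases with
      | zero => exact absurd hij (by simp)
      | succ i =>
        induction j using Fin.cases with
        | zero => simp [hA]
        | succ j =>
          have : i ≠ j := by rintro rfl; exact lt_irrefl _ hij
          simp [hA, this]
  have hmin : ∀ z : Fin (n + 1) → ℤ, z ≠ 0 → δ ≤ ‖A.toLin' (fun i => (z i : ℝ))‖ := by
    intro z hz
    by_contra! hlt
    have hcoord := fun i => (norm_le_pi_norm (A.toLin' (fun i => (z i : ℝ))) i).trans_lt hlt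
    -- If `a = 0`, the first coordinate has size at least `Qⁿ ≥ 1 > δ`. Otherwise a vector shorter
    -- than `δ` would have `|a|_v ≤ Q` and contradict `hbad`.
    by_cases ha : (fun i : Fin n => z i.succ) = 0
    · have h0 := hcoord 0
      have hs : ∀ i : Fin n, z i.succ = 0 := fun i => congrFun ha i
      have hz0 : z 0 ≠ 0 := by
        intro h
        apply hz
        ext i
        induction i using Fin.cases with
        | zero => exact h
        | succ i => exact hs i
      rw [hA0] at h0
      simp only [hs, Int.cast_zero, zero_mul, Finset.sum_const_zero, add_zero, norm_mul,
        Real.norm_eq_abs] at h0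
      have h1 : (1 : ℝ) ≤ |(z 0 : ℝ)| := by
        rw [← Int.cast_abs]; exact_mod_cast Int.one_le_abs hz0
      have h2 : (1 : ℝ) ≤ |Q ^ (n : ℝ)| :=
        (Real.one_le_rpow hQ (by positivity)).trans (le_abs_self _)
      nlinarith
    · have hq : quasinorm v (fun i => ((z i.succ : ℤ) : ℝ)) ≤ Q := by
        refine Real.iSup_le (fun i => ?_) hQ0.le
        refine rpow_one_div_le_of_le_rpow (abs_nonneg _) hQ0.le (hv i) ?_
        have h1 := hcoord i.succ
        rw [hAs, norm_mul, Real.norm_eq_abs, Real.norm_eq_abs,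
          abs_of_pos (Real.rpow_pos_of_pos hQ0 _), Real.rpow_neg hQ0.le, ← div_eq_inv_mul,
          div_lt_iff₀ (Real.rpow_pos_of_pos hQ0 _)] at h1
        have := Real.rpow_pos_of_pos hQ0 (v i)
        nlinarith
      have h1 := hbad _ ha hq
      have h2 : distInt (∑ i : Fin n, ((z i.succ : ℤ) : ℝ) * w i) ≤
          |z 0 + ∑ i : Fin n, ((z i.succ : ℤ) : ℝ) * w i| := by
        refine (round_le _ (-z 0)).trans_eq ?_
        push_cast
        congr 1; ring
      have h3 := hcoord 0
      rw [hA0, norm_mul, Real.norm_eq_abs, Real.norm_eq_abs,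
        abs_of_pos (Real.rpow_pos_of_pos hQ0 _)] at h3
      rw [Real.rpow_neg hQ0.le, ← div_eq_mul_inv, div_le_iff₀ (Real.rpow_pos_of_pos hQ0 _)] at h1
      have := Real.rpow_pos_of_pos hQ0 (n : ℝ)
      nlinarith
  obtain ⟨z, hz⟩ := hlat _ hdet hmin
    (Fin.cons (Q ^ (n : ℝ) * τ) fun i => Q ^ (-v i) * b i)
  have hcoord := fun i => (norm_le_pi_norm _ i).trans_lt hz
  refine ⟨z 0, fun i => z i.succ, ?_, fun i => ?_⟩
  · have h := hcoord 0
    rw [Pi.sub_apply, hA0, Fin.cons_zero, ← mul_sub, norm_mul, Real.norm_eq_abs, Real.norm_eq_abs,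
      abs_of_pos (Real.rpow_pos_of_pos hQ0 _)] at h
    rwa [Real.rpow_neg hQ0.le, ← div_eq_mul_inv, lt_div_iff₀' (Real.rpow_pos_of_pos hQ0 _)]
  · have h := hcoord i.succ
    rw [Pi.sub_apply, hAs, Fin.cons_succ, ← mul_sub, norm_mul, Real.norm_eq_abs, Real.norm_eq_abs,
      abs_of_pos (Real.rpow_pos_of_pos hQ0 _), Real.rpow_neg hQ0.le, ← div_eq_inv_mul,
      div_lt_iff₀ (Real.rpow_pos_of_pos hQ0 _)] at h
    exact h

/-! ### Lipschitz graphs and their neighbourhoods in the sup norm. -/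

/-- The volume of a tube of height `2u` around the graph of `g` over a ball. -/
theorem volume_graph_tube {k : ℕ} {g : (Fin k → ℝ) → ℝ} (hg : Measurable g) (p : Fin k → ℝ)
    {s : ℝ} (hs : 0 < s) (u : ℝ) :
    volume {z : Fin (k + 1) → ℝ | Fin.tail z ∈ Metric.ball p s ∧ |z 0 - g (Fin.tail z)| < u} =
      ENNReal.ofReal ((2 * s) ^ k * (2 * u)) := by
  set W : Set ((Fin k → ℝ) × ℝ) :=
    regionBetween (fun x => g x - u) (fun x => g x + u) (Metric.ball p s) with hW
  have hWm : MeasurableSet W :=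
    measurableSet_regionBetween (hg.sub_const u) (hg.add_const u) measurableSet_ball
  have hpre : {z : Fin (k + 1) → ℝ | Fin.tail z ∈ Metric.ball p s ∧ |z 0 - g (Fin.tail z)| < u} =
      (MeasurableEquiv.piFinSuccAbove (fun _ => ℝ) (0 : Fin (k + 1))) ⁻¹' (Prod.swap ⁻¹' W) := by
    ext z
    have htail : ((MeasurableEquiv.piFinSuccAbove (fun _ => ℝ) (0 : Fin (k + 1))) z).2
        = Fin.tail z := rfl
    have hhead : ((MeasurableEquiv.piFinSuccAbove (fun _ => ℝ) (0 : Fin (k + 1))) z).1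
        = z 0 := rfl
    simp only [hW, regionBetween, Set.mem_preimage, Set.mem_ofPred_eq, Prod.fst_swap,
      Prod.snd_swap, htail, hhead, Set.mem_Ioo, abs_lt]
    refine and_congr_right fun _ => ⟨fun h => ⟨?_, ?_⟩, fun h => ⟨?_, ?_⟩⟩ <;> linarith [h.1, h.2]
  have hvol := (volume_preserving_piFinSuccAbove (fun _ : Fin (k + 1) => ℝ) 0).measure_preimage
    (measurable_swap hWm).nullMeasurableSet
  have hsw := (Measure.measurePreserving_swap (μ := (volume : Measure ℝ))
    (ν := (volume : Measure (Fin k → ℝ)))).measure_preimage hWm.nullMeasurableSet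
  rw [hpre, hvol]
  refine hsw.trans ?_
  rw [hW, volume_regionBetween_eq_lintegral (hg.sub_const u).aemeasurable
    (hg.add_const u).aemeasurable measurableSet_ball]
  have : ∀ y, ((fun x => g x + u) - fun x => g x - u) y = 2 * u := fun y => by
    simp only [Pi.sub_apply]; ring
  simp only [this, lintegral_const, Measure.restrict_apply_univ, Real.volume_pi_ball p hs,
    Fintype.card_fin]
  rw [mul_comm, ← ENNReal.ofReal_mul (by positivity)]

theorem dist_lt_iff_tail {k : ℕ} {x y : Fin (k + 1) → ℝ} {r : ℝ} (hr : 0 < r) :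
    dist x y < r ↔ |x 0 - y 0| < r ∧ dist (Fin.tail x) (Fin.tail y) < r := by
  rw [dist_pi_lt_iff hr, dist_pi_lt_iff hr, Fin.forall_fin_succ]
  rfl

theorem dist_le_iff_tail {k : ℕ} {x y : Fin (k + 1) → ℝ} {r : ℝ} (hr : 0 ≤ r) :
    dist x y ≤ r ↔ |x 0 - y 0| ≤ r ∧ dist (Fin.tail x) (Fin.tail y) ≤ r := by
  rw [dist_pi_le_iff hr, dist_pi_le_iff hr, Fin.forall_fin_succ]
  rfl

/-- The zero set of `x ↦ x₀ + φ(x)`, with `φ` Lipschitz of small constant, is the graph of a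
Lipschitz function of the remaining coordinates. -/
theorem exists_graph_of_lipschitz {k : ℕ} {φ : (Fin (k + 1) → ℝ) → ℝ}
    (hφ : ∀ x y, |φ x - φ y| ≤ 1 / 4 * dist x y) :
    ∃ g : (Fin k → ℝ) → ℝ, (∀ x y, |g x - g y| ≤ 1 / 3 * dist x y) ∧
      (∀ x : Fin (k + 1) → ℝ, x 0 + φ x = 0 ↔ x 0 = g (Fin.tail x)) ∧
      ∀ x : Fin (k + 1) → ℝ, |x 0 - g (Fin.tail x)| ≤ 2 * |x 0 + φ x| := by
  have hex : ∀ u : Fin k → ℝ, ∃ s : ℝ, s + φ (Fin.cons s u) = 0 := by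
    intro u
    -- Zeros on a vertical line are fixed points of a contraction; this needs `φ` on the whole line.
    have hc : ContractingWith (1 / 4) (fun s : ℝ => -φ (Fin.cons s u)) := by
      refine ⟨by rw [div_lt_one (by norm_num)]; norm_num, LipschitzWith.of_dist_le_mul fun s t => ?_⟩
      rw [Real.dist_eq, show -φ (Fin.cons s u) - -φ (Fin.cons t u) =
        -(φ (Fin.cons s u) - φ (Fin.cons t u)) by ring, abs_neg]
      refine (hφ _ _).trans ?_
      have : dist (Fin.cons s u : Fin (k + 1) → ℝ) (Fin.cons t u) ≤ dist s t := by
        rw [dist_le_iff_tail dist_nonneg]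
        simp [Real.dist_eq]
      push_cast
      gcongr
    refine ⟨ContractingWith.fixedPoint _ hc, ?_⟩
    have := hc.fixedPoint_isFixedPt
    rw [Function.IsFixedPt] at this
    linarith
  choose g hg using hex
  -- From `|x₀ - g| ≤ |x₀ + φ(x)| + |x₀ - g| / 4`; the constant `4/3` would do.
  have hbound : ∀ x : Fin (k + 1) → ℝ, |x 0 - g (Fin.tail x)| ≤ 2 * |x 0 + φ x| := by
    intro x
    have h1 := hg (Fin.tail x)
    have h2 := hφ x (Fin.cons (g (Fin.tail x)) (Fin.tail x))
    have h3 : dist x (Fin.cons (g (Fin.tail x)) (Fin.tail x) : Fin (k + 1) → ℝ) ≤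
        |x 0 - g (Fin.tail x)| := by
      rw [dist_le_iff_tail (abs_nonneg _)]
      simp
    have h4 : x 0 - g (Fin.tail x) =
        (x 0 + φ x) - (φ x - φ (Fin.cons (g (Fin.tail x)) (Fin.tail x))) := by linarith
    have h5 := abs_sub (x 0 + φ x) (φ x - φ (Fin.cons (g (Fin.tail x)) (Fin.tail x)))
    rw [← h4] at h5
    have := abs_nonneg (x 0 + φ x)
    linarith
  refine ⟨g, fun u w => ?_, fun x => ⟨fun h => ?_, fun h => ?_⟩, hbound⟩
  · have h1 := hφ (Fin.cons (g u) u) (Fin.cons (g w) w)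
    have h2 : dist (Fin.cons (g u) u : Fin (k + 1) → ℝ) (Fin.cons (g w) w) ≤
        |g u - g w| + dist u w := by
      rw [dist_le_iff_tail (by positivity)]
      simp
    have h3 : g u - g w = -(φ (Fin.cons (g u) u) - φ (Fin.cons (g w) w)) := by
      linarith [hg u, hg w]
    rw [← abs_neg, ← h3] at h1
    linarith
  · have := hbound x
    rw [h, abs_zero, mul_zero] at this
    exact sub_eq_zero.1 (abs_nonpos_iff.1 this)
  · have h1 := hg (Fin.tail x)
    rwa [← h, Fin.cons_self_tail] at h1

/-- The part of a set `Z` that lies within `η` of a point of `Z` of depth `η` in `U`. -/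
def trimmedSet {m : ℕ} (U Z : Set (Fin m → ℝ)) (η : ℝ) : Set (Fin m → ℝ) :=
  {x | x ∈ Z ∧ ∃ y ∈ Z, dist x y < η ∧ Metric.ball y η ⊆ U}

theorem trimmedSet_subset {m : ℕ} (U Z : Set (Fin m → ℝ)) (η : ℝ) :
    trimmedSet U Z η ⊆ Z ∩ U := fun _ ⟨hx, _, _, hxy, hU⟩ => ⟨hx, hU hxy⟩

theorem measurable_of_lipschitz_bound {k : ℕ} {g : (Fin k → ℝ) → ℝ}
    (hg : ∀ x y, |g x - g y| ≤ 1 / 3 * dist x y) : Measurable g :=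
  (LipschitzWith.of_dist_le_mul (K := 1 / 3) fun x y => by
    rw [Real.dist_eq]; simpa using hg x y).continuous.measurable

/-- Neighbourhoods of a trimmed Lipschitz graph have large measure near each of its points. -/
theorem le_volume_thickening_trimmed_graph {k : ℕ} {g : (Fin k → ℝ) → ℝ}
    (hg : ∀ x y, |g x - g y| ≤ 1 / 3 * dist x y)
    (U : Set (Fin (k + 1) → ℝ)) {η ρ l : ℝ}
    (hl : 0 < l) (hlρ : l ≤ ρ) (hρη : ρ ≤ η) {c : Fin (k + 1) → ℝ}
    (hc : c ∈ trimmedSet U {x | x 0 = g (Fin.tail x)} η) :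
    ENNReal.ofReal ((ρ / 4) ^ k * (l / 2)) ≤ volume (Metric.ball c (ρ / 2) ∩
      nbhdIn U (trimmedSet U {x | x 0 = g (Fin.tail x)} η) l) := by
  obtain ⟨hcZ, y, hyZ, hcy, hyU⟩ := hc
  rw [Set.mem_ofPred_eq] at hcZ hyZ
  have hρ : 0 < ρ := hl.trans_le hlρ
  have hη : 0 < η := hρ.trans_le hρη
  -- Moving the centre from `c` towards the deep point `y` makes the ball of radius `ρ / 8` about
  -- `p` fit inside both the `ρ / 4`-ball about `Fin.tail c` and the `η`-ball about `Fin.tail y`,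
  -- even when `c` is near the boundary of `U`.
  set p : Fin k → ℝ := Fin.tail c + (ρ / (8 * η)) • (Fin.tail y - Fin.tail c) with hp
  have hcy' : dist (Fin.tail c) (Fin.tail y) < η := ((dist_lt_iff_tail hη).1 hcy).2
  have hpc : dist p (Fin.tail c) ≤ ρ / 8 := by
    rw [dist_eq_norm, hp, add_sub_cancel_left, norm_smul, Real.norm_of_nonneg (by positivity),
      ← dist_eq_norm, dist_comm]
    calc ρ / (8 * η) * dist (Fin.tail c) (Fin.tail y) ≤ ρ / (8 * η) * η := by gcongr
      _ = ρ / 8 := by field_simp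
  have hpy : dist p (Fin.tail y) ≤ η - ρ / 8 := by
    have h1 : p - Fin.tail y = (1 - ρ / (8 * η)) • (Fin.tail c - Fin.tail y) := by
      rw [hp]; module
    have h2 : ρ / (8 * η) ≤ 1 := by rw [div_le_one (by positivity)]; linarith
    rw [dist_eq_norm, h1, norm_smul, Real.norm_of_nonneg (by linarith), ← dist_eq_norm]
    calc (1 - ρ / (8 * η)) * dist (Fin.tail c) (Fin.tail y) ≤ (1 - ρ / (8 * η)) * η :=
          mul_le_mul_of_nonneg_left hcy'.le (by linarith)
      _ = η - ρ / 8 := by field_simp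
  have htube := volume_graph_tube (measurable_of_lipschitz_bound hg) p
    (show 0 < ρ / 8 by positivity) (l / 4)
  rw [show 2 * (ρ / 8) = ρ / 4 by ring, show 2 * (l / 4) = l / 2 by ring] at htube
  rw [← htube]
  refine measure_mono fun z hz => ?_
  obtain ⟨hzp, hzg⟩ := hz
  rw [Metric.mem_ball] at hzp
  have hzc : dist (Fin.tail z) (Fin.tail c) < ρ / 4 := by
    have := dist_triangle (Fin.tail z) p (Fin.tail c); linarith
  have hzy : dist (Fin.tail z) (Fin.tail y) < η := by
    have := dist_triangle (Fin.tail z) p (Fin.tail y); linarith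
  have hgc := hg (Fin.tail z) (Fin.tail c)
  have hgy := hg (Fin.tail z) (Fin.tail y)
  rw [← hcZ] at hgc
  rw [← hyZ] at hgy
  have hzball : dist z y < η := by
    rw [dist_lt_iff_tail hη]
    refine ⟨?_, hzy⟩
    have := abs_sub_le (z 0) (g (Fin.tail z)) (y 0)
    linarith
  refine ⟨?_, hyU hzball, ?_⟩
  · rw [Metric.mem_ball, dist_lt_iff_tail (by positivity)]
    refine ⟨?_, by linarith⟩
    have := abs_sub_le (z 0) (g (Fin.tail z)) (c 0)
    linarith
  · rw [Metric.mem_thickening_iff]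
    refine ⟨Fin.cons (g (Fin.tail z)) (Fin.tail z), ⟨by simp, y, hyZ, ?_, hyU⟩, ?_⟩
    · rw [dist_lt_iff_tail hη, Fin.cons_zero, Fin.tail_cons]
      exact ⟨by linarith, hzy⟩
    · rw [dist_lt_iff_tail hl, Fin.cons_zero, Fin.tail_cons, dist_self]
      exact ⟨by linarith, hl⟩

/-- Neighbourhoods of a subset of a Lipschitz graph have small measure in balls. -/
theorem volume_ball_inter_thickening_graph_le {k : ℕ} {g : (Fin k → ℝ) → ℝ}
    (hg : ∀ x y, |g x - g y| ≤ 1 / 3 * dist x y)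
    {Z : Set (Fin (k + 1) → ℝ)}
    (hZ : Z ⊆ {x | x 0 = g (Fin.tail x)}) {r l : ℝ} (hr : 0 < r) (hl : 0 < l)
    (b : Fin (k + 1) → ℝ) :
    volume (Metric.ball b r ∩ Metric.thickening l Z) ≤
      ENNReal.ofReal ((2 * r) ^ k * (4 * l)) := by
  -- A point within `l` of the graph has vertical distance less than `l + l / 3 < 2 * l` from it.
  have htube := volume_graph_tube (measurable_of_lipschitz_bound hg) (Fin.tail b) hr (2 * l)
  rw [show 2 * (2 * l) = 4 * l by ring] at htube
  rw [← htube]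
  refine measure_mono fun z hz => ?_
  obtain ⟨hzb, hzZ⟩ := hz
  obtain ⟨w, hwZ, hzw⟩ := Metric.mem_thickening_iff.1 hzZ
  have hw : w 0 = g (Fin.tail w) := hZ hwZ
  obtain ⟨h0, h1⟩ := (dist_lt_iff_tail hl).1 hzw
  refine ⟨((dist_lt_iff_tail hr).1 hzb).2, ?_⟩
  have h2 := hg (Fin.tail w) (Fin.tail z)
  rw [← hw, dist_comm] at h2
  have := abs_sub_le (z 0) (w 0) (g (Fin.tail z))
  linarith [dist_nonneg (x := Fin.tail z) (y := Fin.tail w)]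

/-- Both a trimmed point and its witness lie in `U`. A zero set may therefore be replaced by a
global graph that agrees with it only on `U`. -/
theorem trimmedSet_congr {m : ℕ} {U Z Z' : Set (Fin m → ℝ)} {η : ℝ} (hη : 0 < η)
    (h : ∀ x ∈ U, x ∈ Z ↔ x ∈ Z') : trimmedSet U Z η = trimmedSet U Z' η := by
  ext x
  constructor
  · rintro ⟨hx, y, hy, hxy, hU⟩
    exact ⟨(h x (hU hxy)).1 hx, y, (h y (hU (Metric.mem_ball_self hη))).1 hy, hxy, hU⟩
  · rintro ⟨hx, y, hy, hxy, hU⟩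
    exact ⟨(h x (hU hxy)).2 hx, y, (h y (hU (Metric.mem_ball_self hη))).2 hy, hxy, hU⟩

/-! ### Integer forms with a dominating coefficient. -/

/-- The coefficient of `f_j` in `F` is at least `A` and dominates the other ones by `1/ε`. -/
def IntForm.IsDominated {n : ℕ} (F : IntForm n) (j : Fin n) (A ε : ℝ) : Prop :=
  A ≤ F.1.2 j ∧ ∀ i ≠ j, |(F.1.2 i : ℝ)| ≤ ε * F.1.2 j

/-- The part of the zero set of a dominated form that is regular at the scale of its leading
coefficient; it is empty for the other forms. -/
def resonantSet {m n : ℕ} (U₀ U : Set (Fin m → ℝ)) (f : (Fin m → ℝ) → (Fin n → ℝ))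
    (θ : (Fin m → ℝ) → ℝ) (j : Fin n) (A ε : ℝ) (F : IntForm n) : Set (Fin m → ℝ) :=
  {x | F.IsDominated j A ε ∧ x ∈ trimmedSet U₀ (zeroSet U f θ F) (1 / F.1.2 j)}

theorem IntForm.rpow_coeff_le_height {n : ℕ} (v : Fin n → ℝ) (F : IntForm n) (i : Fin n) :
    |(F.1.2 i : ℝ)| ^ (1 / v i) ≤ F.height v :=
  le_ciSup (f := fun i => |(F.1.2 i : ℝ)| ^ (1 / v i)) (Set.finite_range _).bddAbove i

theorem IntForm.height_nonneg {n : ℕ} (v : Fin n → ℝ) (F : IntForm n) : 0 ≤ F.height v :=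
  Real.iSup_nonneg fun _ => Real.rpow_nonneg (abs_nonneg _) _

theorem IntForm.abs_coeff_le {n : ℕ} {v : Fin n → ℝ} (hv : ∀ i, 0 < v i) (F : IntForm n)
    (i : Fin n) : |(F.1.2 i : ℝ)| ≤ F.height v ^ v i := by
  have h := Real.rpow_le_rpow (by positivity) (F.rpow_coeff_le_height v i) (hv i).le
  rwa [← Real.rpow_mul (abs_nonneg _), one_div_mul_cancel (hv i).ne', Real.rpow_one] at h

/-- The zero set of a dominated form, shifted by `θ`, is a Lipschitz graph. -/
theorem IntForm.exists_graph {k n : ℕ} {U₀ : Set (Fin (k + 1) → ℝ)}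
    {f f' : (Fin (k + 1) → ℝ) → (Fin n → ℝ)} {θ θ' : (Fin (k + 1) → ℝ) → ℝ} {j : Fin n} {L : ℝ}
    (hL : 0 ≤ L) (hf' : ∀ x y, dist (f' x) (f' y) ≤ L * dist x y)
    (hθ' : ∀ x y, dist (θ' x) (θ' y) ≤ L * dist x y) (hff' : Set.EqOn f f' U₀)
    (hθθ' : Set.EqOn θ θ' U₀) (hj : ∀ x ∈ U₀, f x j = x 0) {A ε : ℝ} (hA : 0 < A)
    (hAL : 8 * L ≤ A) (hε : 0 ≤ ε) (hεL : ε * n * L ≤ 1 / 8) {F : IntForm n}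
    (hF : F.IsDominated j A ε) :
    ∃ g : (Fin k → ℝ) → ℝ, (∀ x y, |g x - g y| ≤ 1 / 3 * dist x y) ∧
      (∀ x ∈ U₀, F.eval f x + θ x = 0 ↔ x 0 = g (Fin.tail x)) ∧
      ∀ x ∈ U₀, |x 0 - g (Fin.tail x)| ≤ 2 * |F.eval f x + θ x| / F.1.2 j := by
  set a : ℝ := ((F.1.2 j : ℤ) : ℝ) with ha
  have ha0 : 0 < a := hA.trans_le hF.1
  -- The rest of `F + θ`, divided by the leading coefficient `a` and built from the global
  -- extensions. The other coefficients contribute at most `ε * n * L ≤ 1/8` to its Lipschitz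
  -- constant, and `θ'` at most `L / A ≤ 1/8`.
  set φ : (Fin (k + 1) → ℝ) → ℝ := fun x =>
    (F.1.1 + ∑ i ∈ Finset.univ.erase j, (F.1.2 i : ℝ) * f' x i + θ' x) / a with hφ
  have hlip : ∀ x y, |φ x - φ y| ≤ 1 / 4 * dist x y := by
    intro x y
    have hd : 0 ≤ dist x y := dist_nonneg
    have h1 : φ x - φ y = (∑ i ∈ Finset.univ.erase j, (F.1.2 i : ℝ) * (f' x i - f' y i) +
        (θ' x - θ' y)) / a := by
      simp only [hφ, mul_sub, Finset.sum_sub_distrib]; ring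
    have h2 : |∑ i ∈ Finset.univ.erase j, (F.1.2 i : ℝ) * (f' x i - f' y i)| ≤
        n * (ε * a * (L * dist x y)) := by
      refine (Finset.abs_sum_le_sum_abs _ _).trans ?_
      refine (Finset.sum_le_card_nsmul _ _ (ε * a * (L * dist x y)) fun i hi => ?_).trans ?_
      · rw [abs_mul]
        have h3 : |f' x i - f' y i| ≤ L * dist x y :=
          (dist_le_pi_dist (f' x) (f' y) i).trans (hf' x y)
        exact mul_le_mul (hF.2 i (Finset.ne_of_mem_erase hi)) h3 (abs_nonneg _) (by positivity)
      · rw [nsmul_eq_mul]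
        gcongr
        exact (Finset.card_le_univ _).trans_eq (Fintype.card_fin n)
    rw [h1, abs_div, abs_of_pos ha0, div_le_iff₀ ha0]
    have h4 : |θ' x - θ' y| ≤ L * dist x y := hθ' x y
    have h5 : L * dist x y ≤ 1 / 8 * a * dist x y := by
      gcongr; linarith [hF.1]
    have h6 : n * (ε * a * (L * dist x y)) ≤ 1 / 8 * a * dist x y := by
      have := mul_le_mul_of_nonneg_right hεL (mul_nonneg ha0.le hd)
      linarith
    refine (abs_add_le _ _).trans ?_
    linarith
  have hval : ∀ x ∈ U₀, F.eval f x + θ x = a * (x 0 + φ x) := by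
    intro x hx
    rw [IntForm.eval, ← Finset.add_sum_erase _ _ (Finset.mem_univ j), hj x hx, hff' hx, hθθ' hx,
      hφ]
    field_simp
    ring
  obtain ⟨g, hg, hzero, hbound⟩ := exists_graph_of_lipschitz hlip
  refine ⟨g, hg, fun x hx => ?_, fun x hx => ?_⟩
  · rw [hval x hx, mul_eq_zero, or_iff_right ha0.ne', hzero]
  · rw [hval x hx, abs_mul, abs_of_pos ha0]
    refine (hbound x).trans_eq ?_
    field_simp

/-- A form with small shifted value at a point with badly approximable image, and with
dominating coefficient at an index of maximal weight. -/
theorem exists_dominated_form {n : ℕ} {δ : ℝ} (hδ : 0 < δ) (hδ1 : δ < 1) {v : Fin n → ℝ}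
    (hv : ∀ i, 0 < v i) (hsum : ∑ i, v i = n) {j : Fin n} (hj : ∀ i, v i ≤ v j) {ε : ℝ}
    (hε : 0 < ε) :
    ∃ C K : ℝ, 0 < C ∧ 0 < K ∧ ∀ (w : Fin n → ℝ) (Q : ℝ), 1 ≤ Q →
      (∀ a : Fin n → ℤ, a ≠ 0 → quasinorm v (fun i => (a i : ℝ)) ≤ Q →
        δ * Q ^ (-(n : ℝ)) ≤ distInt (∑ i, (a i : ℝ) * w i)) →
      ∀ τ : ℝ, ∃ F : IntForm n, |F.1.1 + ∑ i, (F.1.2 i : ℝ) * w i + τ| < C * Q ^ (-(n : ℝ)) ∧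
        F.IsDominated j (Q ^ v j) ε ∧ ∀ i, |(F.1.2 i : ℝ)| ≤ K * Q ^ v i := by
  obtain ⟨C, hC, happ⟩ := exists_inhomogeneous_approx n hδ hδ1
  set D : ℝ := C + C / ε + 1 with hD
  have hCε : 0 < C / ε := by positivity
  -- With target `D Q^(v_j) e_j` and errors below `C Q^(v_i)`, this `D` leaves `a_j ≥ (C/ε + 1)
  -- Q^(v_j)`, while maximality of `v_j` gives `|a_i| ≤ C Q^(v_j) ≤ ε a_j` for `i ≠ j`.
  refine ⟨C, D + C, hC, by positivity, fun w Q hQ hbad τ => ?_⟩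
  have hQ0 : 0 < Q := by linarith
  obtain ⟨a₀, a, h0, ha⟩ := happ v hv hsum w Q hQ hbad (-τ) (Pi.single j (D * Q ^ v j))
  have hQj : 0 < Q ^ v j := Real.rpow_pos_of_pos hQ0 _
  have haj := ha j
  rw [Pi.single_eq_same] at haj
  have haj' := abs_lt.1 haj
  have hlow : (C / ε + 1) * Q ^ v j ≤ a j := by
    rw [hD] at haj'; linarith [haj'.1]
  have hother : ∀ i ≠ j, |(a i : ℝ)| ≤ C * Q ^ v i := fun i hi => by
    have := ha i
    rw [Pi.single_eq_of_ne hi, sub_zero] at this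
    exact this.le
  have hpos : 0 < (a j : ℝ) := lt_of_lt_of_le (by positivity) hlow
  refine ⟨⟨(a₀, a), ?_⟩, by simpa using h0, ⟨?_, fun i hi => ?_⟩, fun i => ?_⟩
  · rintro h
    have h1 : a = 0 := congrArg Prod.snd h
    rw [h1] at hpos
    simp at hpos
  · refine le_trans ?_ hlow
    have := mul_pos hCε hQj
    linarith
  · refine (hother i hi).trans ?_
    calc C * Q ^ v i ≤ C * Q ^ v j := by
          gcongr
          exact hj i
      _ = ε * (C / ε * Q ^ v j) := by field_simp
      _ ≤ ε * a j := by gcongr; linarith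
  · have hQi : 0 < Q ^ v i := Real.rpow_pos_of_pos hQ0 _
    by_cases hi : i = j
    · subst hi
      simp only [abs_of_pos hpos]
      linarith [haj'.2]
    · refine (hother i hi).trans ?_
      have : 0 < D := by positivity
      gcongr
      linarith

/-! ### Ingredients of the ubiquity conditions. -/

/-- A `C¹` map is locally Lipschitz and extends globally; for the sup norm on the target this costs
nothing in the constant. The fixed-point argument for the zero sets can then run on all of `ℝ`. -/
theorem exists_lipschitz_extension {m n : ℕ} {U : Set (Fin m → ℝ)} (hU : IsOpen U)
    {f : (Fin m → ℝ) → (Fin n → ℝ)} (hf : ContDiffOn ℝ 1 f U) {θ : (Fin m → ℝ) → ℝ}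
    (hθ : ContDiffOn ℝ 1 θ U) {x₀ : Fin m → ℝ} (hx₀ : x₀ ∈ U) :
    ∃ L : ℝ, 0 ≤ L ∧ ∃ r : ℝ, 0 < r ∧ Metric.ball x₀ r ⊆ U ∧
      ∃ (f' : (Fin m → ℝ) → (Fin n → ℝ)) (θ' : (Fin m → ℝ) → ℝ),
        (∀ x y, dist (f' x) (f' y) ≤ L * dist x y) ∧
        (∀ x y, dist (θ' x) (θ' y) ≤ L * dist x y) ∧
        Set.EqOn f f' (Metric.ball x₀ r) ∧ Set.EqOn θ θ' (Metric.ball x₀ r) := by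
  have hU' := hU.mem_nhds hx₀
  obtain ⟨K₁, t₁, ht₁, hK₁⟩ := (hf.contDiffAt hU').exists_lipschitzOnWith
  obtain ⟨K₂, t₂, ht₂, hK₂⟩ := (hθ.contDiffAt hU').exists_lipschitzOnWith
  obtain ⟨r, hr, hrsub⟩ := Metric.mem_nhds_iff.1 (inter_mem hU' (inter_mem ht₁ ht₂))
  obtain ⟨f', hf', hff'⟩ := hK₁.extend_pi
  obtain ⟨θ', hθ', hθθ'⟩ := hK₂.extend_real
  refine ⟨max K₁ K₂, by positivity, r, hr, fun x hx => (hrsub hx).1, f', θ', fun x y => ?_,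
    fun x y => ?_, fun x hx => hff' (hrsub hx).2.1, fun x hx => hθθ' (hrsub hx).2.2⟩
  · exact (hf'.dist_le_mul x y).trans (by gcongr; exact le_max_left _ _)
  · exact (hθ'.dist_le_mul x y).trans (by gcongr; exact le_max_right _ _)

/-- Intersection conditions for a system of trimmed Lipschitz graphs. -/
theorem intersectionConditions_of_graphs {k : ℕ} {J : Type*} {U : Set (Fin (k + 1) → ℝ)}
    {R : J → Set (Fin (k + 1) → ℝ)} {β : J → ℝ} {ρ : ℝ → ℝ} (T : ℕ)
    (h : ∀ t : ℕ, T ≤ t → ∀ α, β α ≤ 2 ^ t → (R α).Nonempty →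
      ∃ (g : (Fin k → ℝ) → ℝ) (η : ℝ), (∀ x y, |g x - g y| ≤ 1 / 3 * dist x y) ∧
        R α = trimmedSet U {x | x 0 = g (Fin.tail x)} η ∧ ρ (2 ^ t) ≤ η) :
    IntersectionConditions U R β ρ (((k + 1 : ℕ) : ℝ) - 1) := by
  -- These make the two sides equal to the tube volumes `(ρ/4)^k (l/2)` and `(2r)^k (12 l)`, since a
  -- ball of radius `l` has volume `(2l)^(k+1)`.
  refine ⟨(1 / 8) ^ k / 4, 6, by positivity, by norm_num, T, fun t ht α hα c hc l hl hlρ => ?_⟩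
  have hρ : 0 < ρ (2 ^ t) := hl.trans_le hlρ
  obtain ⟨g, η, hg, hR, hη⟩ := h t ht α hα ⟨c, hc⟩
  have hγ : ((k + 1 : ℕ) : ℝ) - 1 = (k : ℕ) := by push_cast; ring
  simp only [hγ, Real.rpow_natCast, Real.volume_pi_ball c hl, Fintype.card_fin]
  constructor
  · rw [← ENNReal.ofReal_mul (by positivity)]
    rw [hR] at hc ⊢
    refine le_trans (le_of_eq ?_) (le_volume_thickening_trimmed_graph hg U hl hlρ hη hc)
    congr 1
    rw [show ρ (2 ^ t) / 4 = 1 / 8 * (ρ (2 ^ t) * 2) by ring]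
    simp only [div_pow, mul_pow, pow_succ]
    field_simp
    norm_num
  · intro α' b _ r hr _
    rw [← ENNReal.ofReal_mul (by positivity)]
    have hsub : R α ⊆ {x | x 0 = g (Fin.tail x)} := by
      rw [hR]; exact fun x hx => hx.1
    have hmono : Metric.ball b r ∩ Metric.ball c (3 * ρ (2 ^ t)) ∩ nbhdIn U (R α) (3 * l) ⊆
        Metric.ball b r ∩ Metric.thickening (3 * l) (R α) := fun z hz => ⟨hz.1.1, hz.2.2⟩
    refine (measure_mono hmono).trans
      ((volume_ball_inter_thickening_graph_le hg hsub hr (show 0 < 3 * l by positivity) b).trans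
        (le_of_eq ?_))
    congr 1
    simp only [div_pow, mul_pow, pow_succ]
    field_simp
    norm_num

/-- The forms of bounded height whose shifted zero set meets a set on which `f` and `θ` are
bounded are finite in number. -/
theorem finite_forms_of_height_le {m n : ℕ} {v : Fin n → ℝ} (hv : ∀ i, 0 < v i)
    {S : Set (Fin m → ℝ)} {f : (Fin m → ℝ) → (Fin n → ℝ)} {θ : (Fin m → ℝ) → ℝ} {M : ℝ}
    (hf : ∀ x ∈ S, ∀ i, |f x i| ≤ M) (hθ : ∀ x ∈ S, |θ x| ≤ M) (H : ℝ) :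
    {F : IntForm n | (∃ x ∈ S, F.eval f x + θ x = 0) ∧ F.height v ≤ H}.Finite := by
  classical
  set N : Fin n → ℤ := fun i => ⌈H ^ v i⌉ with hN
  set N₀ : ℤ := ⌈∑ i, H ^ v i * M + M⌉ with hN₀
  have hfin : ((fun F : IntForm n => F.1) ⁻¹'
      Set.Icc ((-N₀, -N) : ℤ × (Fin n → ℤ)) (N₀, N)).Finite :=
    (Set.finite_Icc _ _).preimage Subtype.val_injective.injOn
  refine hfin.subset fun F hF => ?_
  obtain ⟨⟨x, hx, hzero⟩, hH⟩ := hF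
  have hcoef : ∀ i, |(F.1.2 i : ℝ)| ≤ H ^ v i := fun i =>
    (F.abs_coeff_le hv i).trans (Real.rpow_le_rpow (F.height_nonneg v) hH (hv i).le)
  have hcoef' : ∀ i, |F.1.2 i| ≤ N i := fun i => by
    have := (hcoef i).trans (Int.le_ceil _)
    exact_mod_cast this
  -- The height ignores `a₀`; a zero in `S` expresses `a₀` through the bounded remaining terms.
  have hconst : |(F.1.1 : ℝ)| ≤ ∑ i, H ^ v i * M + M := by
    rw [IntForm.eval] at hzero
    have h1 : (F.1.1 : ℝ) = -(∑ i, (F.1.2 i : ℝ) * f x i + θ x) := by linarith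
    rw [h1, abs_neg]
    refine (abs_add_le _ _).trans (add_le_add ?_ (hθ x hx))
    refine (Finset.abs_sum_le_sum_abs _ _).trans (Finset.sum_le_sum fun i _ => ?_)
    rw [abs_mul]
    exact mul_le_mul (hcoef i) (hf x hx i) (abs_nonneg _) ((abs_nonneg _).trans (hcoef i))
  have hconst' : |F.1.1| ≤ N₀ := by
    have := hconst.trans (Int.le_ceil _)
    exact_mod_cast this
  exact ⟨⟨(abs_le.1 hconst').1, fun i => (abs_le.1 (hcoef' i)).1⟩,
    ⟨(abs_le.1 hconst').2, fun i => (abs_le.1 (hcoef' i)).2⟩⟩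

/-- If a set has upper density at most `ω` in a ball, then its complement eventually occupies a
definite proportion of the ball. -/
theorem eventually_le_volume_diff {m : ℕ} {Φ : ℝ → Set (Fin m → ℝ)} {x : Fin m → ℝ} {r ω : ℝ}
    (hr : 0 < r) (hω : 0 < ω) (hω1 : ω < 1)
    (h : limsup (fun Q => volume (Φ Q ∩ Metric.ball x r)) atTop ≤
      ENNReal.ofReal ω * volume (Metric.ball x r)) :
    ∀ᶠ Q in atTop, ENNReal.ofReal ((1 - ω) / 2) * volume (Metric.ball x r) ≤
      volume (Metric.ball x r \ Φ Q) := by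
  have hV : volume (Metric.ball x r) = ENNReal.ofReal ((2 * r) ^ m) := by
    rw [Real.volume_pi_ball x hr, Fintype.card_fin]
  have hVpos : 0 < (2 * r) ^ m := by positivity
  have hlt : limsup (fun Q => volume (Φ Q ∩ Metric.ball x r)) atTop <
      ENNReal.ofReal ((1 + ω) / 2) * volume (Metric.ball x r) := by
    refine h.trans_lt ?_
    rw [hV, ← ENNReal.ofReal_mul hω.le, ← ENNReal.ofReal_mul (by positivity)]
    refine (ENNReal.ofReal_lt_ofReal_iff (by positivity)).2 ?_
    gcongr
    linarith
  filter_upwards [eventually_lt_of_limsup_lt hlt] with Q hQ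
  have hsplit : volume (Metric.ball x r) ≤
      volume (Φ Q ∩ Metric.ball x r) + volume (Metric.ball x r \ Φ Q) := by
    rw [Set.inter_comm]
    exact measure_le_inter_add_sdiff _ _ _
  have hsum : ENNReal.ofReal ((1 + ω) / 2) * volume (Metric.ball x r) +
      ENNReal.ofReal ((1 - ω) / 2) * volume (Metric.ball x r) = volume (Metric.ball x r) := by
    rw [← add_mul, ← ENNReal.ofReal_add (by positivity) (by linarith)]
    rw [show (1 + ω) / 2 + (1 - ω) / 2 = 1 by ring, ENNReal.ofReal_one, one_mul]
  have hfin : ENNReal.ofReal ((1 + ω) / 2) * volume (Metric.ball x r) ≠ ⊤ :=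
    ENNReal.mul_ne_top ENNReal.ofReal_ne_top (by rw [hV]; exact ENNReal.ofReal_ne_top)
  refine (ENNReal.add_le_add_iff_left hfin).1 ?_
  rw [hsum]
  exact hsplit.trans (by gcongr)

/-- Comparison of volumes. It brings every ball inside `U₀` within reach of the density hypothesis,
which holds for small radii only. -/
theorem radius_le_of_ball_subset {m : ℕ} (hm : 0 < m) {x y : Fin m → ℝ} {r s : ℝ} (hr : 0 < r)
    (hs : 0 < s) (h : Metric.ball x r ⊆ Metric.ball y s) : r ≤ s := by
  have h1 := measure_mono (μ := volume) h
  rw [Real.volume_pi_ball x hr, Real.volume_pi_ball y hs, Fintype.card_fin,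
    ENNReal.ofReal_le_ofReal_iff (by positivity),
    pow_le_pow_iff_left₀ (by positivity) (by positivity) hm.ne'] at h1
  linarith

/-! ### Choice of constants and verification of local ubiquity. -/

theorem mainTheorem6 {m n : ℕ} (hm : 0 < m) (hmn : m ≤ n)
    (v : Fin n → ℝ) (hv_pos : ∀ i, 0 < v i) (hv_sum : ∑ i, v i = n)
    (hv_max : ∀ i, v i ≤ v ⟨0, hm.trans_le hmn⟩)
    (U : Set (Fin m → ℝ)) (hU : IsOpen U)
    (f : (Fin m → ℝ) → (Fin n → ℝ)) (hf : ContDiffOn ℝ 2 f U)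
    (hf_monge : ∀ x ∈ U, ∀ i : Fin m, f x (Fin.castLE hmn i) = x i)
    (θ : (Fin m → ℝ) → ℝ) (hθ : ContDiffOn ℝ 2 θ U)
    (x₀ : Fin m → ℝ) (hx₀ : x₀ ∈ U) (hnice : IsNiceAt U f v x₀) :
    ∃ U₀ : Set (Fin m → ℝ), U₀ ∈ 𝓝 x₀ ∧ U₀ ⊆ U ∧
      ∃ κ₀ κ₁ : ℝ, 0 < κ₀ ∧ 1 < κ₁ ∧
        ∃ R : IntForm n → Set (Fin m → ℝ),
          (∀ F, R F ⊆ zeroSet U f θ F ∩ U₀) ∧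
          IsLocallyUbiquitous U₀ R (fun F => κ₀ * F.height v)
            (fun r => κ₁ * r ^ (-(n : ℝ) - v ⟨0, hm.trans_le hmn⟩)) ((m : ℝ) - 1) := by
  obtain ⟨k, rfl⟩ : ∃ k, m = k + 1 := ⟨m - 1, by omega⟩
  set j : Fin n := ⟨0, hm.trans_le hmn⟩ with hj
  have hn : (0 : ℝ) < n := by exact_mod_cast hm.trans_le hmn
  have hvj := hv_pos j
  obtain ⟨V, hV, -, δ, ω, hδ, hδ1, hω, hω1, s₀, hs₀, hdens⟩ := hnice
  obtain ⟨L, hL, r₁, hr₁, hr₁U, f', θ', hf', hθ', hff', hθθ'⟩ :=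
    exists_lipschitz_extension hU (hf.of_le one_le_two) (hθ.of_le one_le_two) hx₀
  obtain ⟨r₂, hr₂, hr₂V⟩ := Metric.mem_nhds_iff.1 hV
  set r₀ : ℝ := min r₁ (min r₂ s₀) with hr₀_def
  have hr₀ : 0 < r₀ := lt_min hr₁ (lt_min hr₂ hs₀)
  set U₀ : Set (Fin (k + 1) → ℝ) := Metric.ball x₀ r₀ with hU₀
  have hU₀₁ : U₀ ⊆ Metric.ball x₀ r₁ := Metric.ball_subset_ball (min_le_left _ _)
  have hU₀U : U₀ ⊆ U := hU₀₁.trans hr₁U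
  have hU₀V : U₀ ⊆ V := (Metric.ball_subset_ball
    ((min_le_right _ _).trans (min_le_left _ _))).trans hr₂V
  set A : ℝ := 8 * L + 1 with hA_def
  have hA : 0 < A := by positivity
  set ε : ℝ := 1 / (8 * n * (L + 1)) with hε_def
  have hε : 0 < ε := by positivity
  have hεL : ε * n * L ≤ 1 / 8 := by
    have : ε * n * L = 1 / 8 * (L / (L + 1)) := by rw [hε_def]; field_simp
    rw [this]
    have : L / (L + 1) ≤ 1 := by rw [div_le_one (by positivity)]; linarith
    linarith
  obtain ⟨C, K, hC, hK, hform⟩ := exists_dominated_form hδ hδ1 hv_pos hv_sum hv_max hε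
  -- The bounds `|a_i| ≤ K Q^(v_i)` give height at most `S * Q`, so the weight factor `1 / S` puts
  -- the constructed forms in `J_t`.
  set S : ℝ := ∑ i, K ^ (1 / v i) with hS_def
  have hS : 0 < S := Finset.sum_pos (fun i _ => Real.rpow_pos_of_pos hK _) ⟨j, Finset.mem_univ j⟩
  set R := resonantSet U₀ U f θ j A ε with hR_def
  have hgraph : ∀ F : IntForm n, F.IsDominated j A ε →
      ∃ g : (Fin k → ℝ) → ℝ, (∀ x y, |g x - g y| ≤ 1 / 3 * dist x y) ∧
        (∀ x ∈ U₀, F.eval f x + θ x = 0 ↔ x 0 = g (Fin.tail x)) ∧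
        ∀ x ∈ U₀, |x 0 - g (Fin.tail x)| ≤ 2 * |F.eval f x + θ x| / F.1.2 j := fun F hF =>
    F.exists_graph hL hf' hθ' (hff'.mono hU₀₁) (hθθ'.mono hU₀₁)
      (fun x hx => hf_monge x (hU₀U hx) 0) hA (by linarith) hε.le hεL hF
  have hRsub : ∀ F, R F ⊆ zeroSet U f θ F ∩ U₀ := fun F x hx => trimmedSet_subset _ _ _ hx.2
  have hheight : ∀ F : IntForm n, (R F).Nonempty → 0 < F.height v := by
    rintro F ⟨x, ⟨hdom, -⟩, -⟩
    refine lt_of_lt_of_le ?_ (F.rpow_coeff_le_height v j)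
    exact Real.rpow_pos_of_pos (abs_pos.2 (hA.trans_le hdom).ne') _
  -- The graph lies within `2 C Q^(-n) / Q^(v_j)` of the point; the `+ 1` makes the inequality
  -- strict and `κ₁ > 1`.
  set ρ : ℝ → ℝ := fun r => (2 * C + 1) * r ^ (-(n : ℝ) - v j) with hρ_def
  have hρ_pos : ∀ r : ℝ, 0 < r → 0 < ρ r := fun r hr => by
    have := Real.rpow_pos_of_pos hr (-(n : ℝ) - v j)
    positivity
  have hρ_tendsto : Tendsto ρ atTop (𝓝 0) := by
    have := (tendsto_rpow_neg_atTop (show 0 < (n : ℝ) + v j by positivity)).const_mul (2 * C + 1)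
    rw [mul_zero] at this
    refine this.congr fun r => ?_
    rw [hρ_def, neg_add']
  have hpow : Tendsto (fun t : ℕ => (2 : ℝ) ^ t) atTop atTop :=
    tendsto_pow_atTop_atTop_of_one_lt one_lt_two
  refine ⟨U₀, Metric.ball_mem_nhds _ hr₀, hU₀U, 1 / S, 2 * C + 1, by positivity, by linarith, R,
    hRsub, ⟨⟨x₀, r₀, hr₀, rfl⟩, by push_cast; simp, by linarith, hρ_pos, hρ_tendsto,
    fun F hF => mul_pos (by positivity) (hheight F hF), fun t => ?_, ?_, ?_⟩⟩
  · set M : ℝ := max ‖f' x₀‖ ‖θ' x₀‖ + L * r₀ with hM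
    have hbd : ∀ x ∈ U₀, L * dist x x₀ ≤ L * r₀ := fun x hx =>
      mul_le_mul_of_nonneg_left (Metric.mem_ball.1 hx).le hL
    refine (finite_forms_of_height_le hv_pos (S := U₀) (f := f) (θ := θ) (M := M)
      (fun x hx i => ?_) (fun x hx => ?_) (S * 2 ^ t)).subset fun F hF => ⟨?_, ?_⟩
    · rw [hff' (hU₀₁ hx)]
      have h1 : ‖f' x‖ ≤ ‖f' x₀‖ + dist (f' x) (f' x₀) := by
        rw [dist_eq_norm]; exact norm_le_norm_add_norm_sub' _ _
      have h2 := norm_le_pi_norm (f' x) i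
      rw [Real.norm_eq_abs] at h2
      linarith [hf' x x₀, hbd x hx, le_max_left ‖f' x₀‖ ‖θ' x₀‖]
    · rw [hθθ' (hU₀₁ hx), ← Real.norm_eq_abs]
      have h1 : ‖θ' x‖ ≤ ‖θ' x₀‖ + dist (θ' x) (θ' x₀) := by
        rw [dist_eq_norm]; exact norm_le_norm_add_norm_sub' _ _
      linarith [hθ' x x₀, hbd x hx, le_max_right ‖f' x₀‖ ‖θ' x₀‖]
    · obtain ⟨⟨x, hx⟩, -⟩ := hF
      exact ⟨x, (hRsub F hx).2, (hRsub F hx).1.2⟩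
    · have := hF.2
      rw [one_div, inv_mul_le_iff₀ hS] at this
      exact this
  -- For `β_F ≤ Q` one has `a_j ≤ (S Q)^(v_j)`, so this condition says that `ρ(Q)` is at most the
  -- trimming depth `1 / a_j`.
  · have hev : ∀ᶠ Q : ℝ in atTop, (2 * C + 1) * S ^ v j * Q ^ (-(n : ℝ)) ≤ 1 := by
      have := (tendsto_rpow_neg_atTop hn).const_mul ((2 * C + 1) * S ^ v j)
      rw [mul_zero] at this
      exact this.eventually_le_const one_pos
    obtain ⟨T, hT⟩ := eventually_atTop.1 (hpow.eventually hev)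
    refine intersectionConditions_of_graphs T fun t ht F hF hne => ?_
    obtain ⟨x, hdom, -⟩ := id hne
    have haj : 0 < (F.1.2 j : ℝ) := hA.trans_le hdom.1
    obtain ⟨g, hg, hzero, -⟩ := hgraph F hdom
    refine ⟨g, 1 / F.1.2 j, hg, ?_, ?_⟩
    · rw [← trimmedSet_congr (by positivity) (Z := zeroSet U f θ F)
        (Z' := {x | x 0 = g (Fin.tail x)}) (fun x hx => (and_iff_right (hU₀U hx)).trans (hzero x hx))]
      exact Set.ext fun x => and_iff_right hdom
    · have hQ : (0 : ℝ) < 2 ^ t := by positivity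
      rw [one_div, inv_mul_le_iff₀ hS] at hF
      have h1 := (le_abs_self _).trans (F.abs_coeff_le hv_pos j)
      have h2 := Real.rpow_le_rpow (F.height_nonneg v) hF hvj.le
      rw [Real.mul_rpow hS.le hQ.le] at h2
      rw [le_div_iff₀ haj]
      have h3 := (hρ_pos _ hQ).le
      calc ρ (2 ^ t) * F.1.2 j ≤ ρ (2 ^ t) * (S ^ v j * (2 ^ t : ℝ) ^ v j) := by
            gcongr; exact h1.trans h2
        _ = (2 * C + 1) * S ^ v j * (2 ^ t : ℝ) ^ (-(n : ℝ)) := by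
            rw [hρ_def]
            simp only [Real.rpow_sub hQ]
            field_simp
        _ ≤ 1 := hT t ht
  -- Density is used in the concentric ball of half the radius. The remaining `r / 2` leaves room
  -- for the distance `ρ(Q)` to the graph and the depth `1 / a_j ≤ Q^(-v_j)`.
  · refine ⟨(1 - ω) / 2 * (1 / 2) ^ (k + 1), mul_pos (by linarith) (by positivity),
      fun x r hr hsub => ?_⟩
    have hrr₀ : r ≤ r₀ := radius_le_of_ball_subset hm hr hr₀ hsub
    have hrs₀ : r / 2 < s₀ := by
      have : r₀ ≤ s₀ := (min_le_right _ _).trans (min_le_right _ _)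
      linarith
    have hhalf : Metric.ball x (r / 2) ⊆ U₀ :=
      (Metric.ball_subset_ball (by linarith)).trans hsub
    have hdiff := eventually_le_volume_diff (half_pos hr) hω hω1
      (hdens x (r / 2) (half_pos hr) hrs₀ (hhalf.trans hU₀V))
    have hdepth : ∀ᶠ Q : ℝ in atTop, ρ Q + Q ^ (-v j) < r / 2 := by
      have := hρ_tendsto.add (tendsto_rpow_neg_atTop hvj)
      rw [add_zero] at this
      exact this.eventually_lt_const (half_pos hr)
    refine le_liminf_of_le (by isBoundedDefault) ?_
    filter_upwards [hpow.eventually hdiff, hpow.eventually hdepth,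
      hpow.eventually ((tendsto_rpow_atTop hvj).eventually_ge_atTop A)] with t h₁ h₂ h₃
    set Q : ℝ := 2 ^ t with hQ_def
    have hQ : 1 ≤ Q := one_le_pow₀ one_le_two
    have hQ0 : 0 < Q := by linarith
    have hvol : ENNReal.ofReal ((1 - ω) / 2 * (1 / 2) ^ (k + 1)) * volume (Metric.ball x r) =
        ENNReal.ofReal ((1 - ω) / 2) * volume (Metric.ball x (r / 2)) := by
      rw [Real.volume_pi_ball x hr, Real.volume_pi_ball x (half_pos hr), Fintype.card_fin,
        ← ENNReal.ofReal_mul (mul_nonneg (by linarith) (by positivity)),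
        ← ENNReal.ofReal_mul (by linarith), mul_assoc, ← mul_pow]
      congr 3
      ring
    rw [hvol]
    refine h₁.trans (measure_mono ?_)
    rintro z ⟨hz, hzΦ⟩
    have hzU₀ := hhalf hz
    have hbad : ∀ a : Fin n → ℤ, a ≠ 0 → quasinorm v (fun i => (a i : ℝ)) ≤ Q →
        δ * Q ^ (-(n : ℝ)) ≤ distInt (∑ i, (a i : ℝ) * f z i) := by
      intro a ha haQ
      by_contra! hlt
      exact hzΦ ⟨hU₀U hzU₀, a, ha, hlt, haQ⟩
    obtain ⟨F, hFz, hFdom, hFK⟩ := hform (f z) Q hQ hbad (θ z)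
    have hdom : F.IsDominated j A ε := ⟨h₃.trans hFdom.1, hFdom.2⟩
    have haj : 0 < (F.1.2 j : ℝ) := hA.trans_le hdom.1
    obtain ⟨g, hg, hzero, hnear⟩ := hgraph F hdom
    have hQj : 0 < Q ^ v j := Real.rpow_pos_of_pos hQ0 _
    have hdist : |z 0 - g (Fin.tail z)| < ρ Q := by
      refine (hnear z hzU₀).trans_lt ?_
      have hQn : 0 < Q ^ (-(n : ℝ)) := Real.rpow_pos_of_pos hQ0 _
      calc 2 * |F.eval f z + θ z| / F.1.2 j ≤ 2 * (C * Q ^ (-(n : ℝ))) / Q ^ v j := by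
            gcongr
            · exact hFz.le
            · exact hFdom.1
        _ = 2 * C * (Q ^ (-(n : ℝ)) / Q ^ v j) := by ring
        _ < (2 * C + 1) * (Q ^ (-(n : ℝ)) / Q ^ v j) := by
            gcongr
            linarith
        _ = ρ Q := by rw [hρ_def]; simp only [Real.rpow_sub hQ0]
    set y : Fin (k + 1) → ℝ := Fin.cons (g (Fin.tail z)) (Fin.tail z) with hy
    have hzy : dist z y < ρ Q := by
      rw [dist_lt_iff_tail (hρ_pos Q hQ0), hy, Fin.cons_zero, Fin.tail_cons, dist_self]
      exact ⟨hdist, hρ_pos Q hQ0⟩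
    have hη : 1 / (F.1.2 j : ℝ) ≤ Q ^ (-v j) := by
      rw [Real.rpow_neg hQ0.le, ← one_div]
      exact one_div_le_one_div_of_le hQj hFdom.1
    have hyball : Metric.ball y (1 / (F.1.2 j : ℝ)) ⊆ U₀ := by
      intro w hw
      refine hsub ?_
      rw [Metric.mem_ball] at hw hz ⊢
      have h4 := dist_triangle4 w y z x
      rw [dist_comm y z] at h4
      linarith
    have hηpos : 0 < 1 / (F.1.2 j : ℝ) := by positivity
    have hyU₀ : y ∈ U₀ := hyball (Metric.mem_ball_self hηpos)
    have hyZ : y ∈ zeroSet U f θ F :=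
      ⟨hU₀U hyU₀, (hzero y hyU₀).2 (by rw [hy, Fin.cons_zero, Fin.tail_cons])⟩
    -- The zero `y` directly above or below `z` is deep enough to be its own witness.
    have hyR : y ∈ R F := ⟨hdom, hyZ, y, hyZ, by rwa [dist_self], hyball⟩
    have hβ : 1 / S * F.height v ≤ Q := by
      rw [one_div, inv_mul_le_iff₀ hS]
      refine Real.iSup_le (fun i => ?_) (by positivity)
      have hKi : 0 < K ^ (1 / v i) := Real.rpow_pos_of_pos hK _
      refine (rpow_one_div_le_of_le_rpow (abs_nonneg _) (q := K ^ (1 / v i) * Q) (by positivity)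
        (hv_pos i) ?_).trans ?_
      · rw [Real.mul_rpow hKi.le hQ0.le, ← Real.rpow_mul hK.le,
          one_div_mul_cancel (hv_pos i).ne', Real.rpow_one]
        exact hFK i
      · gcongr
        exact Finset.single_le_sum (f := fun i => K ^ (1 / v i))
          (fun i _ => (Real.rpow_pos_of_pos hK _).le) (Finset.mem_univ i)
    refine Set.mem_biUnion (x := F) hβ ⟨⟨hzU₀, ?_⟩, ?_⟩
    · exact Metric.mem_thickening_iff.2 ⟨y, hyR, hzy⟩
    · exact Metric.ball_subset_ball (by linarith) hz

end
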